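/- Let $\Gamma$ be a lattice in a finite-dimensional real vector space $V$ (a discrete subgroup spanning $V$), and let $X=[a_1,\dots,a_m]$ be a finite list of non-zero elements of $\Gamma$ which spans $V$ and whose cone $C(X)=\{\sum_i t_i a_i : t_i\ge 0\}$ is pointed (contains no line). For $\gamma\in\Gamma$ let $\mathcal P_X(\gamma)$ be the number of $(k_1,\dots,k_m)\in\mathbb Z_{\ge 0}^m$ with $\sum_i k_i a_i=\gamma$, and let $B(X)=\{\sum_i t_i a_i : 0\le t_i\le 1\}$ be the zonotope. Call a vector of $V$ singular if it lies in the cone $C(Y)$ generated by some sublist $Y$ of $X$ that does not span $V$ (with $C(\emptyset)=\{0\}$), and call big cell a connected component of the complement in $V$ of the set of singular vectors. For $a\in\Gamma$ and $f:\Gamma\to\mathbb Z$ let $(\nabla_a f)(b)=f(b)-f(b-a)$, and let $DM(X)$ be the space of all $f:\Gamma\to\mathbb Z$ such that $\prod_{a\in X\setminus \underline r}\nabla_a f=0$ for every proper subspace $\underline r\subsetneq V$ spanned by a sublist of $X$, where $X\setminus\underline r$ is the list of those elements of $X$ (with multiplicity) that do not lie in $\underline r$. A function $f:\Gamma\to\mathbb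 Z$ is a quasi-polynomial if there is a subgroup $\Lambda$ of finite index in $\Gamma$ such that on each coset of $\Lambda$ the function $f$ coincides with a real polynomial function on $V$. Then for every big cell $\mathfrak c$ there is a quasi-polynomial $f^{\mathfrak c}\in DM(X)$ such that $\mathcal P_X(\gamma)=f^{\mathfrak c}(\gamma)$ for all $\gamma\in\Gamma\cap(\mathfrak c-B(X))$, where $\mathfrak c-B(X)=\{v-b : v\in\mathfrak c,\ b\in B(X)\}$. -/

import Mathlib

open scoped Pointwise

noncomputable section

namespace VectorPartition

variable {V : Type*} [NormedAddCommGroup V] [NormedSpace ℝ V] {Γ : Submodule ℤ V}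
  {ι : Type*}

/-- The real linear span of the sublist of `X` indexed by `Y`. -/
def spanOf (X : ι → Γ) (Y : Set ι) : Submodule ℝ V :=
  Submodule.span ℝ ((fun i => (X i : V)) '' Y)

/-- The cone `C(Y)`: all linear combinations, with non-negative real coefficients, of the vectors
of the sublist of `X` indexed by `Y` (it is `{0}` for the empty sublist). -/
def coneOf (X : ι → Γ) (Y : Set ι) : PointedCone ℝ V :=
  PointedCone.hull ℝ ((fun i => (X i : V)) '' Y)

/-- The list `X` generates a pointed cone, i.e. `C(X)` contains no line. (Mathlib's word for this is
"salient"; its `PointedCone` only means that the cone contains `0`.) -/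
def GeneratesPointedCone (X : ι → Γ) : Prop :=
  (coneOf X Set.univ : ConvexCone ℝ V).Salient

/-- The zonotope `B(X) = {∑ tᵢ aᵢ : 0 ≤ tᵢ ≤ 1}`. -/
def zonotope [Fintype ι] (X : ι → Γ) : Set V :=
  {v | ∃ t : ι → ℝ, (∀ i, 0 ≤ t i ∧ t i ≤ 1) ∧ v = ∑ i, t i • (X i : V)}

/-- The singular vectors: the union of the cones `C(Y)` over the sublists `Y` of `X` that do not
span `V`. -/
def singularVectors (X : ι → Γ) : Set V :=
  ⋃ (Y : Set ι) (_ : spanOf X Y ≠ ⊤), (coneOf X Y : Set V)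

/-- A big cell: a connected component of the complement in `V` of the singular vectors. -/
def IsBigCell (X : ι → Γ) (c : Set V) : Prop :=
  ∃ v ∈ (singularVectors X)ᶜ, c = connectedComponentIn (singularVectors X)ᶜ v

/-- The partition function `P_X`: the number of families `k` of non-negative integers with
`∑ kᵢ aᵢ = γ`. When `X` is a finite list of non-zero vectors that generates a pointed cone, there are
finitely many such families. -/
def partitionFunction [Fintype ι] (X : ι → Γ) (γ : Γ) : ℤ :=
  (Nat.card {k : ι → ℕ // ∑ i, k i • X i = γ} : ℤ)

/-- The difference operator `(∇_a f)(b) = f(b) - f(b - a)` on integer valued functions on `Γ`. -/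
def nabla (a : Γ) : Module.End ℤ (Γ → ℤ) where
  toFun f b := f b - f (b - a)
  map_add' f g := by
    funext b
    simp only [Pi.add_apply]
    ring
  map_smul' n f := by
    funext b
    simp [mul_sub]

theorem nabla_commute (a b : Γ) : Commute (nabla a) (nabla b) := by
  refine LinearMap.ext fun f => funext fun x => ?_
  simp only [Module.End.mul_apply, nabla, LinearMap.coe_mk, AddHom.coe_mk]
  rw [sub_right_comm x b a]
  ring

/-- `∇_Y = ∏_{a ∈ Y} ∇_a` for the sublist of `X` indexed by the finite set `Y`. -/
def nablaProd (X : ι → Γ) (Y : Finset ι) : Module.End ℤ (Γ → ℤ) :=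
  Y.noncommProd (fun i => nabla (X i)) fun i _ j _ _ => nabla_commute (X i) (X j)

/-- A subspace of `V` is rational relative to `X` if it is the span of a sublist of `X`. -/
def IsRational (X : ι → Γ) (r : Submodule ℝ V) : Prop :=
  ∃ Y : Set ι, r = spanOf X Y

open Classical in
/-- The (indices of the) elements of the list `X` that are not in the subspace `r`. -/
def outside [Fintype ι] (X : ι → Γ) (r : Submodule ℝ V) : Finset ι :=
  Finset.univ.filter fun i => (X i : V) ∉ r

/-- The Dahmen–Micchelli space `DM(X)`: the functions `f : Γ → ℤ` with `∇_{X ∖ r} f = 0` for every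
proper rational subspace `r`. -/
def DM [Fintype ι] (X : ι → Γ) : Submodule ℤ (Γ → ℤ) :=
  ⨅ (r : Submodule ℝ V) (_ : IsRational X r) (_ : r ≠ ⊤), LinearMap.ker (nablaProd X (outside X r))

/-- Real polynomial functions on `V`: the algebra of functions generated by the linear forms. -/
def polynomialFunctions (V : Type*) [AddCommGroup V] [Module ℝ V] : Subalgebra ℝ (V → ℝ) :=
  Algebra.adjoin ℝ (Set.range fun u : Module.Dual ℝ V => (u : V → ℝ))

/-- Quasi-polynomials: functions on `Γ` that coincide with a polynomial on each coset of some
subgroup `Λ` of finite index in `Γ`. -/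
def IsQuasiPolynomial (f : Γ → ℤ) : Prop :=
  ∃ Λ : AddSubgroup Γ, Λ.FiniteIndex ∧
    ∀ γ : Γ, ∃ p ∈ polynomialFunctions V, ∀ l ∈ Λ, (f (γ + l) : ℝ) = p ((γ + l : Γ) : V)

end VectorPartition

end

/-!
For a sublist `Y` write `P_Y` for its partition function. As formal series, `P_Y` is the expansion
of `∏_{a ∈ Y} 1 / (1 - xᵃ)`, so that `∇_{Y ∖ Z} P_Y = P_Z` for `Z ⊆ Y`. When a linear form `φ` does
not vanish on the elements of `Z`, the operator `∇_Z` is invertible on the functions supported in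
some half-space `φ ≥ C`, and the inverse expands the same product in the direction of `φ`
(`halfSpaceInverse`).

Choose for every flat `T` of `X` a linear form `φ_T` that vanishes on the span of `T` and on no
other element of `X`. Recursively over the flats this gives a decomposition of `P_X` into a sum of
terms `∇_{X ∖ T}⁻¹ g_T`, where the inverse is taken in the direction of `φ_T` and `g_T`
(`component`) is supported on the span of `T`. Applying `∇_{S ∖ s}` to the decomposition for a flat
`S` yields the one for `S ∩ s`; therefore `g_S` satisfies the Dahmen–Micchelli conditions of `S`
(`isDM_component`). The term of `X` itself is a function `g_X` in `DM(X)`.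

Now fix a regular vector `v` and take `φ_T` negative at `v` whenever `v` is not in the span of `T`.
The term of such a `T` is supported so far up in the direction of `φ_T` that it vanishes on
`w - B(X)` for all `w` near `v`. If `T ≠ X` but `v` is in the span of `T`, then `v` is not in the
cone of `T`, and `g_T = 0` (`component_eq_zero`). So `P_X = g_X` on `w - B(X)` for all `w` near `v`.

A Dahmen–Micchelli function is determined by its values on a single translate `w - B(X)`
(`IsDM.eq_zero`). Hence the function obtained at `v` is locally constant in `v`, and constant on
the connected set `c`. Finally, Dahmen–Micchelli functions are quasi-polynomials because a power of
`∇_{N b}`, for a suitable `N > 0` and all `b ∈ Γ`, kills them; Newton's interpolation formula then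
exhibits them as polynomials on the cosets of `N Γ` (`IsDM.isQuasiPolynomial`). Both facts are
proved by deleting elements of `X` one at a time.
-/

noncomputable section

open scoped Classical

set_option linter.unusedSectionVars false

namespace VectorPartition

variable {V : Type*} [NormedAddCommGroup V] [NormedSpace ℝ V] {Γ : Submodule ℤ V}
  {ι : Type*}

/-! ### Difference operators along sublists -/

@[simp]
theorem nabla_apply (a : Γ) (f : Γ → ℤ) (b : Γ) : nabla a f b = f b - f (b - a) := rfl

@[simp]
theorem nablaProd_empty (X : ι → Γ) : nablaProd X ∅ = 1 :=
  Finset.noncommProd_empty _ _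

theorem nablaProd_insert (X : ι → Γ) {Y : Finset ι} {a : ι} (ha : a ∉ Y) (f : Γ → ℤ) :
    nablaProd X (insert a Y) f = nabla (X a) (nablaProd X Y f) :=
  LinearMap.congr_fun (Finset.noncommProd_insert_of_notMem Y a _ _ ha) f

@[simp]
theorem nablaProd_singleton (X : ι → Γ) (a : ι) : nablaProd X {a} = nabla (X a) :=
  Finset.noncommProd_singleton _ _

theorem nablaProd_union (X : ι → Γ) {Y Z : Finset ι} (h : Disjoint Y Z) (f : Γ → ℤ) :
    nablaProd X (Y ∪ Z) f = nablaProd X Y (nablaProd X Z f) :=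
  LinearMap.congr_fun (Finset.noncommProd_union_of_disjoint h _ _) f

theorem nablaProd_eq_of_subset (X : ι → Γ) {Y Z : Finset ι} (h : Y ⊆ Z) (f : Γ → ℤ) :
    nablaProd X Z f = nablaProd X (Z \ Y) (nablaProd X Y f) := by
  rw [← nablaProd_union X Finset.sdiff_disjoint, Finset.sdiff_union_of_subset h]

theorem nablaProd_comm (X : ι → Γ) (Y Z : Finset ι) (f : Γ → ℤ) :
    nablaProd X Y (nablaProd X Z f) = nablaProd X Z (nablaProd X Y f) := by
  have : Commute (nablaProd X Y) (nablaProd X Z) :=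
    (Finset.noncommProd_commute _ _ _ _ fun j _ =>
      (Finset.noncommProd_commute _ _ _ _ fun i _ => nabla_commute (X j) (X i)).symm)
  exact LinearMap.congr_fun this.eq f

theorem nablaProd_eq_zero_of_subset (X : ι → Γ) {Y Z : Finset ι} (h : Y ⊆ Z) {f : Γ → ℤ}
    (hf : nablaProd X Y f = 0) : nablaProd X Z f = 0 := by
  rw [nablaProd_eq_of_subset X h, hf, map_zero]

/-- A function invariant under translation by `a` at the lattice points of a subspace `W`
containing `a` is invariant there under all integer multiples of `a`. -/
theorem apply_add_zsmul_of_nabla_eq_zero {f : Γ → ℤ} {W : Submodule ℝ V} {a : Γ} (ha : (a : V) ∈ W)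
    (h : ∀ γ : Γ, (γ : V) ∈ W → nabla a f γ = 0) (n : ℤ) {γ : Γ} (hγ : (γ : V) ∈ W) :
    f (γ + n • a) = f γ := by
  have hmem : ∀ n : ℤ, ((γ + n • a : Γ) : V) ∈ W := fun n => by
    push_cast
    exact W.add_mem hγ (zsmul_mem ha n)
  have hstep : ∀ n : ℤ, f (γ + (n + 1) • a) = f (γ + n • a) := fun n => by
    have h1 := h _ (hmem (n + 1))
    rw [nabla_apply, sub_eq_zero] at h1
    rw [h1]
    congr 1
    rw [add_smul, one_smul]
    abel
  induction n with
  | zero => simp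
  | succ k ih => rw [hstep, ih]
  | pred k ih => rw [← ih, ← hstep, sub_add_cancel]

theorem apply_add_sum_zsmul_of_nabla_eq_zero {f : Γ → ℤ} {W : Submodule ℝ V} {X : ι → Γ}
    {Y : Finset ι} (hY : ∀ i ∈ Y, (X i : V) ∈ W)
    (h : ∀ i ∈ Y, ∀ γ : Γ, (γ : V) ∈ W → nabla (X i) f γ = 0) (n : ι → ℤ)
    {γ : Γ} (hγ : (γ : V) ∈ W) :
    f (γ + ∑ i ∈ Y, n i • X i) = f γ := by
  induction Y using Finset.induction_on generalizing γ with
  | empty => simp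
  | insert a Y ha ih =>
    have haW := hY a (Finset.mem_insert_self _ _)
    rw [Finset.sum_insert ha, ← add_assoc,
      ih (fun i hi => hY i (Finset.mem_insert_of_mem hi))
        (fun i hi => h i (Finset.mem_insert_of_mem hi)),
      apply_add_zsmul_of_nabla_eq_zero haW (h a (Finset.mem_insert_self _ _)) _ hγ]
    push_cast
    exact W.add_mem hγ (zsmul_mem haW _)

/-! ### Dahmen–Micchelli functions of a sublist -/

/-- The Dahmen–Micchelli conditions for the sublist of `X` indexed by `Y`: the operator `∇_{Y ∖ s}`
kills `f` for every subspace `s` that misses an element of the sublist. Quantifying over all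
subspaces rather than the rational ones does not change the condition, since `Y ∖ s` depends only
on the span of `Y ∩ s`. -/
def IsDM (X : ι → Γ) (Y : Finset ι) (f : Γ → ℤ) : Prop :=
  ∀ s : Submodule ℝ V, (∃ i ∈ Y, (X i : V) ∉ s) → nablaProd X {i ∈ Y | (X i : V) ∉ s} f = 0

theorem IsDM.sub {X : ι → Γ} {Y : Finset ι} {f g : Γ → ℤ} (hf : IsDM X Y f) (hg : IsDM X Y g) :
    IsDM X Y (f - g) := fun s hs => by
  rw [map_sub, hf s hs, hg s hs, sub_zero]

theorem spanOf_mono (X : ι → Γ) {Y Z : Set ι} (h : Y ⊆ Z) : spanOf X Y ≤ spanOf X Z :=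
  Submodule.span_mono (Set.image_mono h)

theorem mem_spanOf (X : ι → Γ) {Y : Set ι} {i : ι} (hi : i ∈ Y) : (X i : V) ∈ spanOf X Y :=
  Submodule.subset_span ⟨i, hi, rfl⟩

theorem spanOf_le {X : ι → Γ} {Y : Set ι} {W : Submodule ℝ V} :
    spanOf X Y ≤ W ↔ ∀ i ∈ Y, (X i : V) ∈ W := by
  rw [spanOf, Submodule.span_le, Set.image_subset_iff]
  rfl

theorem exists_sum_of_mem_spanOf {X : ι → Γ} {Y : Finset ι} {v : V} (hv : v ∈ spanOf X Y) :
    ∃ c : ι → ℝ, v = ∑ i ∈ Y, c i • (X i : V) := by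
  obtain ⟨c, hc⟩ := (Submodule.mem_span_image_finset_iff_exists_fun' ℝ).1 hv
  exact ⟨c, hc.symm⟩

theorem IsDM.mem_DM [Fintype ι] {X : ι → Γ} (hspan : spanOf X Set.univ = ⊤) {f : Γ → ℤ}
    (hf : IsDM X Finset.univ f) : f ∈ DM X := by
  simp only [DM, Submodule.mem_iInf, LinearMap.mem_ker]
  intro r _ hr
  refine hf r ?_
  by_contra! h
  exact hr (top_le_iff.1 (hspan ▸ spanOf_le.2 fun i _ => h i (Finset.mem_univ i)))

/-- Deletion of `a`: if `Y ∖ a` does not span the span of `Y`, then `∇_a` is one of the operators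
in the Dahmen–Micchelli conditions for `Y`. -/
theorem IsDM.nabla_eq_zero {X : ι → Γ} {Y : Finset ι} {f : Γ → ℤ} (hf : IsDM X Y f) {a : ι}
    (ha : a ∈ Y) (h : (X a : V) ∉ spanOf X (Y.erase a : Finset ι)) : nabla (X a) f = 0 := by
  have := hf _ ⟨a, ha, h⟩
  rwa [show ({i ∈ Y | (X i : V) ∉ spanOf X (Y.erase a : Finset ι)} : Finset ι) = {a} from ?_,
    nablaProd_singleton] at this
  ext i
  rw [Finset.mem_filter, Finset.mem_singleton]
  constructor
  · rintro ⟨hi, hi'⟩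
    by_contra hia
    exact hi' (mem_spanOf X (Finset.mem_coe.2 (Finset.mem_erase.2 ⟨hia, hi⟩)))
  · rintro rfl
    exact ⟨ha, h⟩

theorem IsDM.nabla_erase {X : ι → Γ} {Y : Finset ι} {f : Γ → ℤ} (hf : IsDM X Y f) {a : ι}
    (ha : a ∈ Y) : IsDM X (Y.erase a) (nabla (X a) f) := by
  rintro s ⟨i, hi, his⟩
  have h := hf s ⟨i, Finset.mem_of_mem_erase hi, his⟩
  rw [← nablaProd_singleton, nablaProd_comm]
  by_cases has : (X a : V) ∈ s
  · rw [Finset.filter_erase, Finset.erase_eq_of_notMem (by simp [has]), h, map_zero]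
  · rwa [nablaProd_singleton, Finset.filter_erase, ← nablaProd_insert X (Finset.notMem_erase _ _),
      Finset.insert_erase (Finset.mem_filter.2 ⟨ha, has⟩)]

theorem spanOf_erase_eq {X : ι → Γ} {Y : Finset ι} {a : ι}
    (h : (X a : V) ∈ spanOf X (Y.erase a : Finset ι)) :
    spanOf X (Y.erase a : Finset ι) = spanOf X Y := by
  refine le_antisymm (spanOf_mono X (Finset.coe_subset.2 (Finset.erase_subset _ _)))
    (spanOf_le.2 fun i hi => ?_)
  by_cases hia : i = a
  · rwa [hia]
  · exact mem_spanOf X (Finset.mem_coe.2 (Finset.mem_erase.2 ⟨hia, hi⟩))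

/-- The translated zonotope `u - B(Y)` of the sublist indexed by `Y`. -/
def subZonotope (X : ι → Γ) (Y : Finset ι) (u : V) : Set V :=
  {v | ∃ t : ι → ℝ, (∀ i ∈ Y, 0 ≤ t i ∧ t i ≤ 1) ∧ v = u - ∑ i ∈ Y, t i • (X i : V)}

/-- A Dahmen–Micchelli function of `Y` that vanishes on the lattice points of a single translate
`u - B(Y)` vanishes on all lattice points of the span of `Y`. By deletion, all the differences
`∇_a f` vanish there, so `f` is periodic, and `u - B(Y)` meets every class of periods. -/
theorem IsDM.eq_zero {X : ι → Γ} {u : V} : ∀ {Y : Finset ι} {f : Γ → ℤ}, IsDM X Y f →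
    u ∈ spanOf X Y → (∀ γ : Γ, (γ : V) ∈ subZonotope X Y u → f γ = 0) →
    ∀ γ : Γ, (γ : V) ∈ spanOf X Y → f γ = 0 := by
  intro Y
  induction Y using Finset.strongInduction with
  | H Y ih =>
    intro f hf hu h0 γ hγ
    have hinv : ∀ a ∈ Y, ∀ γ : Γ, (γ : V) ∈ spanOf X Y → nabla (X a) f γ = 0 := by
      intro a ha
      by_cases h : (X a : V) ∈ spanOf X (Y.erase a : Finset ι)
      · have hs := spanOf_erase_eq h
        rw [← hs]
        refine ih _ (Finset.erase_ssubset ha) (hf.nabla_erase ha) (hs ▸ hu) ?_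
        rintro γ ⟨t, ht, hγ⟩
        have key : ∀ c : ℝ, 0 ≤ c → c ≤ 1 →
            (γ : V) - c • (X a : V) ∈ subZonotope X Y u := by
          intro c hc0 hc1
          refine ⟨Function.update t a c, fun i hi => ?_, ?_⟩
          · by_cases hia : i = a
            · subst hia
              simp [hc0, hc1]
            · rw [Function.update_of_ne hia]
              exact ht i (Finset.mem_erase.2 ⟨hia, hi⟩)
          · rw [← Finset.add_sum_erase _ _ ha, hγ, Function.update_self, add_comm,
              sub_add_eq_sub_sub]
            congr 2
            refine Finset.sum_congr rfl fun i hi => ?_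
            rw [Function.update_of_ne (Finset.ne_of_mem_erase hi)]
        rw [nabla_apply, h0 γ (by simpa using key 0 le_rfl zero_le_one),
          h0 (γ - X a) (by simpa using key 1 zero_le_one le_rfl), sub_zero]
      · rw [hf.nabla_eq_zero ha h]
        intros
        rfl
    obtain ⟨c, hc⟩ := exists_sum_of_mem_spanOf (Submodule.sub_mem _ hu hγ)
    rw [← apply_add_sum_zsmul_of_nabla_eq_zero (fun i hi => mem_spanOf X (Finset.mem_coe.2 hi)) hinv
      (fun i => ⌊c i⌋) hγ]
    refine h0 _ ⟨fun i => Int.fract (c i), fun i _ => ⟨Int.fract_nonneg _, (Int.fract_lt_one _).le⟩,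
      ?_⟩
    push_cast
    simp only [Int.fract, sub_smul, Finset.sum_sub_distrib, Int.cast_smul_eq_zsmul, ← hc]
    abel

/-! ### Quasi-polynomiality -/

/-- The subgroup generated by a sublist that spans `V` has finite index in `Γ`, since every class
is represented in a bounded set; its exponent can be chosen uniformly in the sublist. -/
theorem exists_nsmul_eq_sum_zsmul [FiniteDimensional ℝ V] [DiscreteTopology Γ] [Fintype ι]
    (X : ι → Γ) :
    ∃ N : ℕ, 0 < N ∧ ∀ Y : Finset ι, spanOf X Y = ⊤ → ∀ γ : Γ, ∃ n : ι → ℤ,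
      N • γ = ∑ i ∈ Y, n i • X i := by
  have key : ∀ Y : Finset ι, ∃ N : ℕ, 0 < N ∧ (spanOf X Y = ⊤ → ∀ γ : Γ,
      N • γ ∈ Submodule.span ℤ (X '' Y)) := by
    intro Y
    by_cases hY : spanOf X Y = ⊤
    swap
    · exact ⟨1, one_pos, fun h => absurd h hY⟩
    set H := Submodule.span ℤ (X '' Y)
    have hfin : (Metric.closedBall (0 : V) (∑ i ∈ Y, ‖(X i : V)‖) ∩ (Γ : Set V)).Finite := by
      change ((_ : Set V) ∩ Γ.toAddSubgroup).Finite
      have : DiscreteTopology Γ.toAddSubgroup := (inferInstance : DiscreteTopology Γ)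
      exact Metric.finite_isBounded_inter_isClosed DiscreteTopology.isDiscrete
        Metric.isBounded_closedBall inferInstance
    have hfin' : ((fun γ : Γ => (γ : V)) ⁻¹'
        Metric.closedBall (0 : V) (∑ i ∈ Y, ‖(X i : V)‖)).Finite := by
      refine Set.Finite.of_finite_image (hfin.subset ?_) Subtype.coe_injective.injOn
      rintro _ ⟨γ, hγ, rfl⟩
      exact ⟨hγ, γ.2⟩
    have : Finite (Γ ⧸ H) := by
      refine Set.finite_univ_iff.1 ((hfin'.image H.mkQ).subset ?_)
      rintro q -
      obtain ⟨γ, rfl⟩ := H.mkQ_surjective q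
      obtain ⟨c, hc⟩ := exists_sum_of_mem_spanOf (X := X) (Y := Y) (v := (γ : V))
        (by rw [hY]; trivial)
      refine ⟨γ - ∑ i ∈ Y, ⌊c i⌋ • X i, ?_, ?_⟩
      · have : ((γ - ∑ i ∈ Y, ⌊c i⌋ • X i : Γ) : V) = ∑ i ∈ Y, Int.fract (c i) • (X i : V) := by
          push_cast
          simp only [Int.fract, sub_smul, Finset.sum_sub_distrib, Int.cast_smul_eq_zsmul, ← hc]
        rw [Set.mem_preimage, this, mem_closedBall_zero_iff]
        refine (norm_sum_le _ _).trans (Finset.sum_le_sum fun i _ => ?_)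
        rw [norm_smul, Real.norm_of_nonneg (Int.fract_nonneg _)]
        exact mul_le_of_le_one_left (norm_nonneg _) (Int.fract_lt_one _).le
      · refine (Submodule.Quotient.eq H).2 ?_
        rw [sub_sub_cancel_left]
        exact H.neg_mem (H.sum_mem fun i hi => H.smul_mem _ (Submodule.subset_span ⟨i, hi, rfl⟩))
    refine ⟨Nat.card (Γ ⧸ H), Nat.card_pos, fun _ γ => ?_⟩
    rw [← Submodule.Quotient.mk_eq_zero, Submodule.Quotient.mk_smul]
    exact card_nsmul_eq_zero'
  choose N hN0 hN using key
  refine ⟨∏ Y, N Y, Finset.prod_pos fun Y _ => hN0 Y, fun Y hY γ => ?_⟩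
  obtain ⟨k, hk⟩ := Finset.dvd_prod_of_mem N (Finset.mem_univ Y)
  obtain ⟨n, hn⟩ := (Submodule.mem_span_image_finset_iff_exists_fun' ℤ).1 (hN Y hY (k • γ))
  exact ⟨n, by rw [hn, hk, mul_smul]⟩

/-- If all `N • γ` lie in the group generated by each spanning sublist, then `∇_{N • b}` acts
nilpotently on the Dahmen–Micchelli functions of a spanning sublist: after deletion a power of it
kills all differences `∇_a f`, so that what it makes of `f` is periodic under `N • b`. -/
theorem IsDM.nabla_nsmul_pow_eq_zero {X : ι → Γ} {N : ℕ}
    (hN : ∀ Y : Finset ι, spanOf X Y = ⊤ → ∀ γ : Γ, ∃ n : ι → ℤ, N • γ = ∑ i ∈ Y, n i • X i)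
    (b : Γ) : ∀ {Y : Finset ι} {f : Γ → ℤ}, IsDM X Y f → spanOf X Y = ⊤ →
    (nabla (N • b) ^ (Y.card + 1)) f = 0 := by
  intro Y
  induction Y using Finset.strongInduction with
  | H Y ih =>
    intro f hf hY
    have hinv : ∀ a ∈ Y, nabla (X a) ((nabla (N • b) ^ Y.card) f) = 0 := by
      intro a ha
      have hcomm : nabla (X a) ((nabla (N • b) ^ Y.card) f)
          = (nabla (N • b) ^ Y.card) (nabla (X a) f) :=
        LinearMap.congr_fun ((nabla_commute (X a) (N • b)).pow_right Y.card).eq f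
      rw [hcomm]
      by_cases h : (X a : V) ∈ spanOf X (Y.erase a : Finset ι)
      · rw [← Finset.card_erase_add_one ha]
        exact ih _ (Finset.erase_ssubset ha) (hf.nabla_erase ha) ((spanOf_erase_eq h).trans hY)
      · rw [hf.nabla_eq_zero ha h, map_zero]
    obtain ⟨n, hn⟩ := hN Y hY b
    rw [pow_succ', Module.End.mul_apply]
    funext γ
    have := apply_add_sum_zsmul_of_nabla_eq_zero (W := ⊤) (fun i _ => Submodule.mem_top)
      (fun i hi γ _ => congrFun (hinv i hi) γ) n (γ := γ - N • b) Submodule.mem_top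
    rw [← hn, sub_add_cancel] at this
    rw [nabla_apply, this, sub_self]
    rfl

/-- Newton's formula with backward differences, on all integers. -/
theorem apply_add_zsmul_eq_sum_multichoose {e : Γ} {f : Γ → ℤ} {d : ℕ}
    (h : (nabla e ^ (d + 1)) f = 0) (m : ℤ) (γ : Γ) :
    f (γ + m • e) = ∑ j ∈ Finset.range (d + 1), Ring.multichoose m j * (nabla e ^ j) f γ := by
  have hshift : ∀ (m : ℤ) (γ : Γ),
      ∑ j ∈ Finset.range (d + 1), Ring.multichoose (m + 1) j * (nabla e ^ j) f (γ - e)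
        = ∑ j ∈ Finset.range (d + 1), Ring.multichoose m j * (nabla e ^ j) f γ := by
    intro m γ
    have hpart : ∀ k : ℕ,
        ∑ j ∈ Finset.range (k + 1), Ring.multichoose (m + 1) j * (nabla e ^ j) f (γ - e)
          = ∑ j ∈ Finset.range (k + 1), Ring.multichoose m j * (nabla e ^ j) f γ
            - Ring.multichoose (m + 1) k * (nabla e ^ (k + 1)) f γ := by
      intro k
      induction k with
      | zero =>
        simp
      | succ k ih =>
        rw [Finset.sum_range_succ, ih, Finset.sum_range_succ _ (k + 1),
          Ring.multichoose_succ_succ m k, pow_succ' (nabla e) (k + 1), Module.End.mul_apply,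
          nabla_apply]
        ring
    rw [hpart d, h, Pi.zero_apply, mul_zero, sub_zero]
  induction m generalizing γ with
  | zero =>
    rw [Finset.sum_range_succ']
    simp [Ring.multichoose_zero_succ]
  | succ k ih =>
    have := hshift k (γ + e)
    rw [add_sub_cancel_right] at this
    rw [this, ← ih, add_smul, one_smul]
    congr 1
    abel
  | pred k ih =>
    rw [← hshift, sub_add_cancel, ← ih, sub_smul, one_smul]
    congr 1
    abel

theorem exists_polynomial_eval_eq_multichoose (j : ℕ) :
    ∃ q : Polynomial ℝ, ∀ m : ℤ, q.eval (m : ℝ) = (Ring.multichoose m j : ℤ) := by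
  refine ⟨Polynomial.C ((j.factorial : ℝ)⁻¹) * ascPochhammer ℝ j, fun m => ?_⟩
  have h := Ring.factorial_nsmul_multichoose_eq_ascPochhammer m j
  rw [Polynomial.ascPochhammer_smeval_eq_eval] at h
  have hcast : (ascPochhammer ℝ j).eval (m : ℝ) = ((ascPochhammer ℤ j).eval m : ℤ) := by
    rw [← ascPochhammer_map (Int.castRingHom ℝ), Polynomial.eval_map,
      ← eq_intCast (Int.castRingHom ℝ) m, Polynomial.eval₂_at_apply, eq_intCast]
  rw [Polynomial.eval_mul, Polynomial.eval_C, hcast, ← h, nsmul_eq_mul]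
  push_cast
  rw [inv_mul_cancel_left₀ (by positivity)]

/-- A function killed by a power of each `∇_{eᵢ}` is, along integer combinations of the `eᵢ`, a
polynomial in the coefficients. The coefficients are read off by functions `c i` in a subalgebra
`A` of the functions on `V`. -/
theorem exists_mem_subalgebra_of_nabla_pow_eq_zero {κ : Type*} (A : Subalgebra ℝ (V → ℝ))
    {e : κ → Γ} {c : κ → V → ℝ} (hcA : ∀ i, c i ∈ A) {x : (κ → ℤ) → V}
    (hx : ∀ m i, c i (x m) = m i) {d : ℕ} (s : Finset κ) :
    ∀ {f : Γ → ℤ}, (∀ i, (nabla (e i) ^ (d + 1)) f = 0) → ∀ γ : Γ, ∃ p ∈ A, ∀ m : κ → ℤ,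
      (f (γ + ∑ i ∈ s, m i • e i) : ℝ) = p (x m) := by
  induction s using Finset.induction_on with
  | empty =>
    intro f _ γ
    exact ⟨algebraMap ℝ _ (f γ), A.algebraMap_mem _, fun m => by simp⟩
  | insert k s hk ih =>
    intro f hf γ
    have hf' : ∀ j i, (nabla (e i) ^ (d + 1)) ((nabla (e k) ^ j) f) = 0 := by
      intro j i
      rw [← Module.End.mul_apply, ((nabla_commute (e i) (e k)).pow_pow (d + 1) j).eq,
        Module.End.mul_apply, hf, map_zero]
    choose p hpA hp using fun j => ih (hf' j) γ
    choose q hq using exists_polynomial_eval_eq_multichoose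
    refine ⟨∑ j ∈ Finset.range (d + 1), Polynomial.aeval (c k) (q j) * p j,
      A.sum_mem fun j _ => A.mul_mem ?_ (hpA j), fun m => ?_⟩
    · exact Algebra.adjoin_le (Set.singleton_subset_iff.2 (hcA k))
        (Polynomial.aeval_mem_adjoin_singleton ℝ (c k))
    · rw [Finset.sum_insert hk, add_comm (m k • e k), ← add_assoc,
        apply_add_zsmul_eq_sum_multichoose (hf k), Finset.sum_apply]
      push_cast
      refine Finset.sum_congr rfl fun j _ => ?_
      rw [hp, Pi.mul_apply, ← hq, ← hx m k]
      congr 1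
      exact (Polynomial.aeval_fn_apply (q j) (c k) (x m)).symm

theorem IsDM.isQuasiPolynomial [FiniteDimensional ℝ V] [DiscreteTopology Γ] [IsZLattice ℝ Γ]
    [Fintype ι] {X : ι → Γ} (hspan : spanOf X Set.univ = ⊤) {f : Γ → ℤ}
    (hf : IsDM X Finset.univ f) : IsQuasiPolynomial f := by
  obtain ⟨N, hN0, hN⟩ := exists_nsmul_eq_sum_zsmul X
  have hd := fun b => hf.nabla_nsmul_pow_eq_zero hN b (by rwa [Finset.coe_univ])
  have := ZLattice.module_finite ℝ Γ
  have := ZLattice.module_free ℝ Γ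
  refine ⟨(nsmulAddMonoidHom (α := Γ) N).range,
    ⟨by rw [AddSubgroup.index_range_nsmul]; positivity⟩, fun γ => ?_⟩
  let b := Module.Free.chooseBasis ℤ Γ
  let B := b.ofZLatticeBasis ℝ Γ
  let x : (Module.Free.ChooseBasisIndex ℤ Γ → ℤ) → V := fun m => (γ + ∑ i, m i • N • b i : Γ)
  obtain ⟨p, hpA, hp⟩ := exists_mem_subalgebra_of_nabla_pow_eq_zero (polynomialFunctions V)
    (e := fun i => N • b i) (x := x)
    (c := fun i => (N : ℝ)⁻¹ • (⇑(B.coord i) - algebraMap ℝ (V → ℝ) (B.coord i γ)))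
    (fun i => Subalgebra.smul_mem _ (Subalgebra.sub_mem _
      (Algebra.subset_adjoin (Set.mem_range_self (B.coord i))) (Subalgebra.algebraMap_mem _ _)) _)
    (fun m i => by
      have hB : ∀ y : Γ, B.coord i y = b.repr y i := fun y => by
        rw [Module.Basis.coord_apply]
        exact b.ofZLatticeBasis_repr_apply ℝ Γ y i
      simp only [x, Pi.smul_apply, Pi.sub_apply, Pi.algebraMap_apply, hB, map_add, map_sum,
        map_zsmul, map_nsmul, Finsupp.add_apply, Finsupp.coe_finsetSum, Finset.sum_apply,
        Finsupp.smul_apply, Module.Basis.repr_self, Finsupp.single_apply]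
      have : (N : ℝ) ≠ 0 := by positivity
      simp
      field_simp)
    Finset.univ (fun i => hd (b i)) γ
  refine ⟨p, hpA, ?_⟩
  rintro _ ⟨y, rfl⟩
  have hy : γ + nsmulAddMonoidHom N y = γ + ∑ i, b.repr y i • N • b i := by
    simp only [smul_comm _ N, ← Finset.smul_sum, b.sum_repr, nsmulAddMonoidHom_apply]
  rw [hy]
  exact hp _

/-! ### Inverting difference operators in a half-space -/

/-- The functions on `Γ` whose support lies in some half-space `φ ≥ C`. On these functions `∇_a` is
invertible as soon as `φ a ≠ 0`: this is the expansion of `1 / (1 - xᵃ)` in the direction in which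
`φ` grows. -/
def IsBoundedBelow (φ : Module.Dual ℝ V) (f : Γ → ℤ) : Prop :=
  ∃ C : ℝ, ∀ γ, f γ ≠ 0 → C ≤ φ γ

theorem IsBoundedBelow.sub {φ : Module.Dual ℝ V} {f g : Γ → ℤ} (hf : IsBoundedBelow φ f)
    (hg : IsBoundedBelow φ g) : IsBoundedBelow φ (f - g) := by
  obtain ⟨C, hC⟩ := hf
  obtain ⟨D, hD⟩ := hg
  refine ⟨min C D, fun γ hγ => ?_⟩
  by_cases h : f γ = 0
  · have : g γ ≠ 0 := by
      rintro h'
      simp [h, h'] at hγ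
    exact (min_le_right _ _).trans (hD γ this)
  · exact (min_le_left _ _).trans (hC γ h)

theorem IsBoundedBelow.nabla {φ : Module.Dual ℝ V} {f : Γ → ℤ} (hf : IsBoundedBelow φ f) (a : Γ) :
    IsBoundedBelow φ (nabla a f) := by
  refine hf.sub (g := fun γ => f (γ - a)) ?_
  obtain ⟨C, hC⟩ := hf
  refine ⟨C + φ a, fun γ hγ => ?_⟩
  have := hC _ hγ
  push_cast at this
  rw [map_sub] at this
  linarith

theorem IsBoundedBelow.nablaProd {φ : Module.Dual ℝ V} {f : Γ → ℤ} (hf : IsBoundedBelow φ f)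
    (X : ι → Γ) (Z : Finset ι) : IsBoundedBelow φ (nablaProd X Z f) := by
  induction Z using Finset.induction_on with
  | empty => simpa using hf
  | insert a Z ha ih =>
    rw [nablaProd_insert X ha]
    exact ih.nabla _

theorem IsBoundedBelow.eq_zero_of_nabla {φ : Module.Dual ℝ V} {f : Γ → ℤ} (hf : IsBoundedBelow φ f)
    {a : Γ} (ha : φ a ≠ 0) (h : VectorPartition.nabla a f = 0) : f = 0 := by
  obtain ⟨C, hC⟩ := hf
  funext γ
  by_contra hγ
  have hinv : ∀ n : ℤ, f (γ + n • a) = f γ := fun n =>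
    apply_add_zsmul_of_nabla_eq_zero (W := ⊤) Submodule.mem_top (fun γ _ => congrFun h γ) n
      Submodule.mem_top
  have hle : ∀ n : ℤ, C ≤ φ γ + n * φ a := fun n => by
    have := hC (γ + n • a) (by rwa [hinv])
    push_cast at this
    rwa [map_add, map_zsmul, zsmul_eq_mul] at this
  rcases ha.lt_or_gt with ha | ha
  · obtain ⟨n, hn⟩ := exists_int_gt ((C - φ γ) / φ a)
    rw [div_lt_iff_of_neg ha] at hn
    linarith [hle n]
  · obtain ⟨n, hn⟩ := exists_int_lt ((C - φ γ) / φ a)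
    rw [lt_div_iff₀ ha] at hn
    linarith [hle n]

theorem IsBoundedBelow.eq_zero_of_nablaProd {φ : Module.Dual ℝ V} {X : ι → Γ} {Z : Finset ι}
    (hZ : ∀ i ∈ Z, φ (X i) ≠ 0) {f : Γ → ℤ} (hf : IsBoundedBelow φ f)
    (h : VectorPartition.nablaProd X Z f = 0) : f = 0 := by
  induction Z using Finset.induction_on with
  | empty => simpa using h
  | insert a Z ha ih =>
    rw [nablaProd_insert X ha] at h
    exact ih (fun i hi => hZ i (Finset.mem_insert_of_mem hi))
      ((hf.nablaProd X Z).eq_zero_of_nabla (hZ a (Finset.mem_insert_self _ _)) h)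

theorem exists_nabla_eq_of_pos {φ : Module.Dual ℝ V} {a : Γ} (ha : 0 < φ a) {W : Submodule ℝ V}
    (haW : (a : V) ∈ W) {g : Γ → ℤ} {C : ℝ} (hC : ∀ γ, g γ ≠ 0 → C ≤ φ γ)
    (hW : ∀ γ, g γ ≠ 0 → (γ : V) ∈ W) :
    ∃ h : Γ → ℤ, nabla a h = g ∧ (∀ γ, h γ ≠ 0 → C ≤ φ γ) ∧ ∀ γ, h γ ≠ 0 → (γ : V) ∈ W := by
  have hsum : ∀ γ, Summable fun k : ℕ => g (γ - k • a) := by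
    intro γ
    obtain ⟨n, hn⟩ := exists_nat_gt ((φ γ - C) / φ a)
    rw [div_lt_iff₀ ha] at hn
    refine summable_of_hasFiniteSupport ((Set.finite_Iio n).subset fun k hk => ?_)
    have := hC _ hk
    push_cast at this
    rw [map_sub, map_nsmul, nsmul_eq_mul] at this
    by_contra hkn
    have : (n : ℝ) ≤ k := by exact_mod_cast not_lt.1 hkn
    nlinarith
  have hex : ∀ γ, ∑' k : ℕ, g (γ - k • a) ≠ 0 → ∃ k : ℕ, g (γ - k • a) ≠ 0 := by
    intro γ hγ
    by_contra! h
    simp [h] at hγ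
  refine ⟨fun γ => ∑' k : ℕ, g (γ - k • a), ?_, ?_, ?_⟩
  · funext γ
    rw [nabla_apply, (hsum γ).tsum_eq_zero_add, zero_smul, sub_zero]
    simp only [add_smul, one_smul, sub_add_eq_sub_sub_swap, add_sub_cancel_right]
  · intro γ hγ
    obtain ⟨k, hk⟩ := hex γ hγ
    have := hC _ hk
    push_cast at this
    rw [map_sub, map_nsmul, nsmul_eq_mul] at this
    have : 0 ≤ (k : ℝ) * φ a := by positivity
    linarith
  · intro γ hγ
    obtain ⟨k, hk⟩ := hex γ hγ
    have := W.add_mem (hW _ hk) (nsmul_mem haW k)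
    push_cast at this
    rwa [sub_add_cancel] at this

theorem exists_nabla_eq {φ : Module.Dual ℝ V} {a : Γ} (ha : φ a ≠ 0) {W : Submodule ℝ V}
    (haW : (a : V) ∈ W) {g : Γ → ℤ} {C : ℝ} (hC : ∀ γ, g γ ≠ 0 → C ≤ φ γ)
    (hW : ∀ γ, g γ ≠ 0 → (γ : V) ∈ W) :
    ∃ h : Γ → ℤ, nabla a h = g ∧ (∀ γ, h γ ≠ 0 → C + max 0 (-φ a) ≤ φ γ) ∧
      ∀ γ, h γ ≠ 0 → (γ : V) ∈ W := by
  rcases ha.lt_or_gt with ha | ha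
  · -- Here `∇_a = -τ_a ∇_{-a}` with `τ_a` the translation by `a`, whose inverse shifts
    -- supports by `-a`.
    obtain ⟨h, h1, h2, h3⟩ := exists_nabla_eq_of_pos (a := -a)
      (by push_cast; rw [map_neg]; linarith) (by push_cast; exact W.neg_mem haW) hC hW
    refine ⟨fun γ => -h (γ + a), ?_, fun γ hγ => ?_, fun γ hγ => ?_⟩
    · funext γ
      rw [← h1, nabla_apply, nabla_apply, sub_add_cancel, sub_neg_eq_add γ a]
      ring
    · have := h2 _ (neg_ne_zero.1 hγ)
      push_cast at this
      rw [map_add] at this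
      rw [max_eq_right (by linarith)]
      linarith
    · have := W.sub_mem (h3 _ (neg_ne_zero.1 hγ)) haW
      push_cast at this
      rwa [add_sub_cancel_right] at this
  · obtain ⟨h, h1, h2, h3⟩ := exists_nabla_eq_of_pos ha haW hC hW
    refine ⟨h, h1, fun γ hγ => ?_, h3⟩
    rw [max_eq_left (by linarith), add_zero]
    exact h2 γ hγ

/-- Each factor with `φ a < 0` pushes the support up by `-φ a`, since the expansion of
`1 / (1 - xᵃ)` in powers of `x⁻ᵃ` starts with `-x⁻ᵃ`. -/
theorem exists_nablaProd_eq {φ : Module.Dual ℝ V} {X : ι → Γ} {Z : Finset ι}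
    (hZ : ∀ i ∈ Z, φ (X i) ≠ 0) {W : Submodule ℝ V} (hZW : ∀ i ∈ Z, (X i : V) ∈ W) {g : Γ → ℤ}
    {C : ℝ} (hC : ∀ γ, g γ ≠ 0 → C ≤ φ γ) (hW : ∀ γ, g γ ≠ 0 → (γ : V) ∈ W) :
    ∃ h : Γ → ℤ, nablaProd X Z h = g ∧ (∀ γ, h γ ≠ 0 → C + ∑ i ∈ Z, max 0 (-φ (X i)) ≤ φ γ) ∧
      ∀ γ, h γ ≠ 0 → (γ : V) ∈ W := by
  induction Z using Finset.induction_on generalizing g C with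
  | empty => exact ⟨g, by simp, by simpa using hC, hW⟩
  | insert a Z ha ih =>
    obtain ⟨h₁, e₁, hC₁, hW₁⟩ := exists_nabla_eq (hZ a (Finset.mem_insert_self _ _))
      (hZW a (Finset.mem_insert_self _ _)) hC hW
    obtain ⟨h, e, hC', hW'⟩ := ih (fun i hi => hZ i (Finset.mem_insert_of_mem hi))
      (fun i hi => hZW i (Finset.mem_insert_of_mem hi)) hC₁ hW₁
    refine ⟨h, by rw [nablaProd_insert X ha, e, e₁], fun γ hγ => ?_, hW'⟩
    rw [Finset.sum_insert ha, ← add_assoc]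
    exact hC' γ hγ

/-- The inverse of `∇_Z` on functions bounded below for `φ`: the convolution of `g` with the
expansion of `∏_{a ∈ Z} 1 / (1 - xᵃ)` in the direction of `φ` (and `0` where there is no inverse).
-/
def halfSpaceInverse (φ : Module.Dual ℝ V) (X : ι → Γ) (Z : Finset ι) (g : Γ → ℤ) : Γ → ℤ :=
  if h : ∃ h : Γ → ℤ, IsBoundedBelow φ h ∧ nablaProd X Z h = g then h.choose else 0

section HalfSpaceInverse

variable {φ : Module.Dual ℝ V} {X : ι → Γ} {Z : Finset ι}

theorem halfSpaceInverse_eq (hZ : ∀ i ∈ Z, φ (X i) ≠ 0) {g h : Γ → ℤ} (hb : IsBoundedBelow φ h)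
    (h' : nablaProd X Z h = g) : halfSpaceInverse φ X Z g = h := by
  have hex : ∃ h : Γ → ℤ, IsBoundedBelow φ h ∧ nablaProd X Z h = g := ⟨h, hb, h'⟩
  rw [halfSpaceInverse, dif_pos hex, ← sub_eq_zero]
  refine (hex.choose_spec.1.sub hb).eq_zero_of_nablaProd hZ ?_
  rw [map_sub, hex.choose_spec.2, h', sub_self]

theorem halfSpaceInverse_spec (hZ : ∀ i ∈ Z, φ (X i) ≠ 0) {g : Γ → ℤ} (hg : IsBoundedBelow φ g) :
    IsBoundedBelow φ (halfSpaceInverse φ X Z g) ∧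
      nablaProd X Z (halfSpaceInverse φ X Z g) = g := by
  obtain ⟨C, hC⟩ := hg
  obtain ⟨h, e, hC', -⟩ := exists_nablaProd_eq (W := ⊤) hZ (fun _ _ => Submodule.mem_top) hC
    (fun _ _ => Submodule.mem_top)
  have hex : ∃ h : Γ → ℤ, IsBoundedBelow φ h ∧ nablaProd X Z h = g := ⟨h, ⟨_, hC'⟩, e⟩
  rw [halfSpaceInverse, dif_pos hex]
  exact hex.choose_spec

theorem le_of_halfSpaceInverse_ne_zero (hZ : ∀ i ∈ Z, φ (X i) ≠ 0) {g : Γ → ℤ} {C : ℝ}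
    (hC : ∀ γ, g γ ≠ 0 → C ≤ φ γ) {γ : Γ} (hγ : halfSpaceInverse φ X Z g γ ≠ 0) :
    C + ∑ i ∈ Z, max 0 (-φ (X i)) ≤ φ γ := by
  obtain ⟨h, e, hC', -⟩ := exists_nablaProd_eq (W := ⊤) hZ (fun _ _ => Submodule.mem_top) hC
    (fun _ _ => Submodule.mem_top)
  rw [halfSpaceInverse_eq hZ ⟨_, hC'⟩ e] at hγ
  exact hC' γ hγ

theorem mem_of_halfSpaceInverse_ne_zero (hZ : ∀ i ∈ Z, φ (X i) ≠ 0) {W : Submodule ℝ V}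
    (hZW : ∀ i ∈ Z, (X i : V) ∈ W) {g : Γ → ℤ} (hg : IsBoundedBelow φ g)
    (hW : ∀ γ, g γ ≠ 0 → (γ : V) ∈ W) {γ : Γ} (hγ : halfSpaceInverse φ X Z g γ ≠ 0) :
    (γ : V) ∈ W := by
  obtain ⟨C, hC⟩ := hg
  obtain ⟨h, e, hC', hW'⟩ := exists_nablaProd_eq hZ hZW hC hW
  rw [halfSpaceInverse_eq hZ ⟨_, hC'⟩ e] at hγ
  exact hW' γ hγ

theorem nablaProd_halfSpaceInverse {Y : Finset ι} (hYZ : Y ⊆ Z) (hZ : ∀ i ∈ Z, φ (X i) ≠ 0)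
    {g : Γ → ℤ} (hg : IsBoundedBelow φ g) :
    nablaProd X Y (halfSpaceInverse φ X Z g) = halfSpaceInverse φ X (Z \ Y) g := by
  obtain ⟨hb, he⟩ := halfSpaceInverse_spec hZ hg
  refine (halfSpaceInverse_eq (fun i hi => hZ i (Finset.sdiff_subset hi))
    (hb.nablaProd X Y) ?_).symm
  rw [← nablaProd_eq_of_subset X hYZ, he]

theorem nablaProd_halfSpaceInverse_eq_zero (hZ : ∀ i ∈ Z, φ (X i) ≠ 0) {Y : Finset ι}
    {g : Γ → ℤ} (hg : IsBoundedBelow φ g) (h : nablaProd X Y g = 0) :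
    nablaProd X Y (halfSpaceInverse φ X Z g) = 0 := by
  obtain ⟨hb, he⟩ := halfSpaceInverse_spec hZ hg
  refine (hb.nablaProd X Y).eq_zero_of_nablaProd hZ ?_
  rw [nablaProd_comm, he, h]

theorem halfSpaceInverse_empty {g : Γ → ℤ} (hg : IsBoundedBelow φ g) :
    halfSpaceInverse φ X ∅ g = g :=
  halfSpaceInverse_eq (by simp) hg (by simp)

end HalfSpaceInverse

/-! ### Partition functions of sublists -/

/-- The partition function of the sublist of `X` indexed by `S`. -/
def sublistPartition [Fintype ι] (X : ι → Γ) (S : Finset ι) (γ : Γ) : ℤ :=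
  (Set.ncard {k : ι → ℕ | (∀ i ∉ S, k i = 0) ∧ ∑ i, k i • X i = γ} : ℤ)

theorem sublistPartition_univ [Fintype ι] (X : ι → Γ) :
    sublistPartition X Finset.univ = partitionFunction X := by
  funext γ
  simp only [sublistPartition, Finset.mem_univ, not_true_eq_false, false_implies, implies_true,
    true_and]
  rfl

theorem sum_smul_mem_coneOf (X : ι → Γ) (Y : Finset ι) {t : ι → ℝ} (ht : ∀ i ∈ Y, 0 ≤ t i) :
    ∑ i ∈ Y, t i • (X i : V) ∈ coneOf X Y :=
  Submodule.sum_mem _ fun i hi =>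
    Submodule.smul_mem _ (⟨t i, ht i hi⟩ : NNReal) (Submodule.subset_span ⟨i, hi, rfl⟩)

theorem mem_coneOf_of_sublistPartition_ne_zero [Fintype ι] {X : ι → Γ} {S : Finset ι} {γ : Γ}
    (h : sublistPartition X S γ ≠ 0) : (γ : V) ∈ coneOf X S := by
  obtain ⟨k, hk, rfl⟩ := Set.nonempty_of_ncard_ne_zero (Nat.cast_ne_zero.1 h)
  have := sum_smul_mem_coneOf X S (t := fun i => (k i : ℝ)) fun i _ => Nat.cast_nonneg _
  push_cast
  rw [← Finset.sum_subset (Finset.subset_univ S) fun i _ hi => by rw [hk i hi, zero_smul]]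
  simpa only [Nat.cast_smul_eq_nsmul] using this

theorem coneOf_le_spanOf (X : ι → Γ) (Y : Set ι) {v : V} (hv : v ∈ coneOf X Y) :
    v ∈ spanOf X Y :=
  PointedCone.hull_le_span ℝ _ hv

/-- A linear relation with coefficients in `ℕ` between non-zero vectors would put a line into the
cone, so the solutions form an antichain, and Dickson's lemma applies. -/
theorem finite_setOf_sum_eq [Fintype ι] {X : ι → Γ} (hX : ∀ i, X i ≠ 0)
    (hpointed : GeneratesPointedCone X) (γ : Γ) : {k : ι → ℕ | ∑ i, k i • X i = γ}.Finite := by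
  refine WellQuasiOrderedLE.finite_of_isAntichain fun k hk k' hk' hne hle => hne ?_
  by_contra
  obtain ⟨j, hj⟩ := Function.ne_iff.1 hne
  have hlt : k j < k' j := lt_of_le_of_ne (hle j) hj
  have hzero : ∑ i, ((k' i : ℝ) - k i) • (X i : V) = 0 := by
    have h1 := congrArg (Subtype.val : Γ → V) (hk'.trans (Eq.symm hk))
    push_cast at h1
    simp only [sub_smul, Finset.sum_sub_distrib, Nat.cast_smul_eq_nsmul, h1, sub_self]
  have hnn : ∀ i, 0 ≤ (k' i : ℝ) - k i := fun i => by
    rw [sub_nonneg]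
    exact_mod_cast hle i
  have hmem : ∀ Y : Finset ι, ∑ i ∈ Y, ((k' i : ℝ) - k i) • (X i : V) ∈ coneOf X Set.univ :=
    fun Y => Submodule.span_mono (Set.image_mono (Set.subset_univ _))
      (sum_smul_mem_coneOf X Y fun i _ => hnn i)
  refine hpointed (((k' j : ℝ) - k j) • (X j : V)) (by simpa using hmem {j}) ?_ ?_
  · refine smul_ne_zero (sub_ne_zero.2 ?_) (fun h => hX j (Subtype.ext h))
    exact_mod_cast hlt.ne'
  · rw [← Finset.add_sum_erase _ _ (Finset.mem_univ j)] at hzero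
    rw [neg_eq_of_add_eq_zero_right hzero]
    exact hmem _

theorem nabla_sublistPartition_insert [Fintype ι] {X : ι → Γ} (hX : ∀ i, X i ≠ 0)
    (hpointed : GeneratesPointedCone X) {S : Finset ι} {j : ι} (hj : j ∉ S) :
    nabla (X j) (sublistPartition X (insert j S)) = sublistPartition X S := by
  funext γ
  rw [nabla_apply, sub_eq_iff_eq_add]
  simp only [sublistPartition]
  rw [← Nat.cast_add, Nat.cast_inj]
  have hinj : Function.Injective fun k : ι → ℕ => k + Pi.single j 1 := add_left_injective _
  rw [← Set.ncard_image_of_injective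
    {k : ι → ℕ | (∀ i ∉ insert j S, k i = 0) ∧ ∑ i, k i • X i = γ - X j} hinj,
    ← Set.ncard_union_eq ?_
      ((finite_setOf_sum_eq hX hpointed γ).subset fun k hk => hk.2)
      (((finite_setOf_sum_eq hX hpointed (γ - X j)).subset fun k hk => hk.2).image _)]
  · congr 1
    ext k
    simp only [Set.mem_union, Set.mem_image, Set.mem_ofPred_eq]
    have hsum : ∀ l : ι → ℕ, ∑ i, (l + Pi.single j 1 : ι → ℕ) i • X i = ∑ i, l i • X i + X j := by
      intro l
      simp [add_smul, Finset.sum_add_distrib, Pi.single_apply, ite_smul]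
    constructor
    · rintro ⟨hk, hγ⟩
      rcases Nat.eq_zero_or_pos (k j) with h0 | hpos
      · refine Or.inl ⟨fun i hi => ?_, hγ⟩
        by_cases hij : i = j
        · rw [hij, h0]
        · exact hk i (by simp [hij, hi])
      · have hk' : k - Pi.single j 1 + Pi.single j 1 = k := by
          funext i
          by_cases hij : i = j
          · subst hij
            simp
            omega
          · simp [hij]
        refine Or.inr ⟨k - Pi.single j 1, ⟨fun i hi => ?_, ?_⟩, hk'⟩
        · simp [hk i hi]
        · rw [eq_sub_iff_add_eq, ← hsum, hk', hγ]
    · rintro (⟨hk, hγ⟩ | ⟨l, ⟨hl, hγ⟩, rfl⟩)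
      · exact ⟨fun i hi => hk i fun h => hi (Finset.mem_insert_of_mem h), hγ⟩
      · refine ⟨fun i hi => ?_, by rw [hsum, hγ, sub_add_cancel]⟩
        have : i ≠ j := fun h => hi (h ▸ Finset.mem_insert_self _ _)
        simp [hl i hi, this]
  · rw [Set.disjoint_left]
    rintro _ ⟨hk, -⟩ ⟨l, -, rfl⟩
    have := hk j hj
    simp at this

theorem nablaProd_sublistPartition [Fintype ι] {X : ι → Γ} (hX : ∀ i, X i ≠ 0)
    (hpointed : GeneratesPointedCone X) {S T : Finset ι} (hTS : T ⊆ S) :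
    nablaProd X (S \ T) (sublistPartition X S) = sublistPartition X T := by
  have key : ∀ Z : Finset ι, Disjoint Z T →
      nablaProd X Z (sublistPartition X (Z ∪ T)) = sublistPartition X T := by
    intro Z
    induction Z using Finset.induction_on with
    | empty => simp
    | insert a Z ha ih =>
      intro hd
      rw [Finset.disjoint_insert_left] at hd
      rw [nablaProd_insert X ha, ← nablaProd_singleton, nablaProd_comm, nablaProd_singleton,
        Finset.insert_union, nabla_sublistPartition_insert hX hpointed
          (by simp [ha, hd.1]), ih hd.2]
  have := key (S \ T) Finset.sdiff_disjoint
  rwa [Finset.sdiff_union_of_subset hTS] at this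

/-! ### Decomposition of the partition function along flats -/

/-- A sublist is a flat if it contains every element of `X` that lies in its span. -/
def IsFlat (X : ι → Γ) (S : Finset ι) : Prop :=
  ∀ i, (X i : V) ∈ spanOf X S → i ∈ S

theorem IsFlat.filter_mem {X : ι → Γ} {S : Finset ι} (hS : IsFlat X S) (s : Submodule ℝ V) :
    IsFlat X {i ∈ S | (X i : V) ∈ s} := by
  intro i hi
  refine Finset.mem_filter.2 ⟨hS i (spanOf_mono X ?_ hi), spanOf_le.2 ?_ hi⟩
  · exact Finset.coe_subset.2 (Finset.filter_subset _ _)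
  · exact fun j hj => (Finset.mem_filter.1 hj).2

/-- A choice, for each flat `T`, of a linear form `φ T` that vanishes on the span of `T` and on no
other element of `X`. -/
structure IsFlatForms (X : ι → Γ) (φ : Finset ι → Module.Dual ℝ V) : Prop where
  eq_zero : ∀ T, IsFlat X T → ∀ x ∈ spanOf X T, φ T x = 0
  ne_zero : ∀ T, IsFlat X T → ∀ i ∉ T, φ T (X i) ≠ 0

/-- The component of the partition function at the flat `S`: what is left of the partition function
of `S` after subtracting, for all smaller flats `T`, the component at `T` convolved with the
expansion of `∏_{a ∈ S ∖ T} 1 / (1 - xᵃ)` in the direction of `φ T`. -/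
def component [Fintype ι] (X : ι → Γ) (φ : Finset ι → Module.Dual ℝ V) (S : Finset ι) : Γ → ℤ :=
  sublistPartition X S - ∑ T ∈ {T ∈ S.ssubsets | IsFlat X T}.attach,
    halfSpaceInverse (φ T) X (S \ T) (component X φ T)
termination_by S.card
decreasing_by
  exact Finset.card_lt_card (Finset.mem_ssubsets.1 (Finset.mem_filter.1 T.2).1)

theorem component_eq [Fintype ι] (X : ι → Γ) (φ : Finset ι → Module.Dual ℝ V) (S : Finset ι) :
    component X φ S = sublistPartition X S - ∑ T ∈ S.ssubsets with IsFlat X T,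
      halfSpaceInverse (φ T) X (S \ T) (component X φ T) := by
  rw [component, Finset.sum_attach _ fun T => halfSpaceInverse (φ T) X (S \ T) (component X φ T)]

section Component

variable [Fintype ι] {X : ι → Γ} {φ : Finset ι → Module.Dual ℝ V}

theorem IsFlatForms.nonneg (hφ : IsFlatForms X φ) {T : Finset ι} (hT : IsFlat X T) {g : Γ → ℤ}
    (hg : ∀ γ, g γ ≠ 0 → (γ : V) ∈ spanOf X T) (γ : Γ) (hγ : g γ ≠ 0) : 0 ≤ φ T γ :=
  (hφ.eq_zero T hT _ (hg γ hγ)).ge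

theorem IsFlatForms.ne_zero_of_mem_sdiff (hφ : IsFlatForms X φ) {T : Finset ι} (hT : IsFlat X T)
    {S : Finset ι} : ∀ i ∈ S \ T, φ T (X i) ≠ 0 :=
  fun i hi => hφ.ne_zero T hT i (Finset.mem_sdiff.1 hi).2

theorem mem_spanOf_of_component_ne_zero (hφ : IsFlatForms X φ) :
    ∀ (S : Finset ι) (γ : Γ), component X φ S γ ≠ 0 → (γ : V) ∈ spanOf X S := by
  intro S
  induction S using Finset.strongInduction with
  | H S ih =>
    intro γ hγ
    by_contra hmem
    refine hγ ?_
    rw [component_eq, Pi.sub_apply, Finset.sum_apply, Finset.sum_eq_zero, sub_zero]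
    · by_contra h
      exact hmem (coneOf_le_spanOf X _ (mem_coneOf_of_sublistPartition_ne_zero h))
    · intro T hT
      rw [Finset.mem_filter, Finset.mem_ssubsets] at hT
      by_contra h
      refine hmem (mem_of_halfSpaceInverse_ne_zero (hφ.ne_zero_of_mem_sdiff hT.2)
        (fun i hi => mem_spanOf X (Finset.mem_coe.2 (Finset.mem_sdiff.1 hi).1))
        ⟨0, hφ.nonneg hT.2 (ih T hT.1)⟩
        (fun γ hγ => spanOf_mono X (Finset.coe_subset.2 hT.1.subset) (ih T hT.1 γ hγ)) h)

theorem isBoundedBelow_component (hφ : IsFlatForms X φ) {T : Finset ι} (hT : IsFlat X T) :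
    IsBoundedBelow (φ T) (component X φ T) :=
  ⟨0, hφ.nonneg hT (mem_spanOf_of_component_ne_zero hφ T)⟩

/-- The components satisfy the Dahmen–Micchelli conditions. For a subspace `s` put `S' = S ∩ s`.
The operator `∇_{S ∖ s}` turns the partition function of `S` into that of `S'`; it turns the term
of a flat `T ⊆ S'` into the corresponding term for `S'`, and it kills the terms of the other flats,
whose components satisfy the Dahmen–Micchelli conditions themselves. So the decomposition for `S`
becomes the one for `S'`, and nothing is left over. -/
theorem isDM_component (hX : ∀ i, X i ≠ 0) (hpointed : GeneratesPointedCone X)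
    (hφ : IsFlatForms X φ) : ∀ S : Finset ι, IsFlat X S → IsDM X S (component X φ S) := by
  intro S
  induction S using Finset.strongInduction with
  | H S ih =>
    rintro hS s ⟨a, haS, has⟩
    set S' : Finset ι := {i ∈ S | (X i : V) ∈ s} with hS'
    have hflat : IsFlat X S' := hS.filter_mem s
    have hsub : S' ⊂ S := Finset.filter_ssubset.2 ⟨a, haS, has⟩
    have hout : ({i ∈ S | (X i : V) ∉ s} : Finset ι) = S \ S' := by
      rw [hS', Finset.filter_not]
    rw [hout, component_eq, map_sub, map_sum, nablaProd_sublistPartition hX hpointed hsub.subset]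
    have hterm : ∀ T ∈ ({T ∈ S.ssubsets | IsFlat X T} : Finset (Finset ι)),
        nablaProd X (S \ S') (halfSpaceInverse (φ T) X (S \ T) (component X φ T)) =
          if T ⊆ S' then halfSpaceInverse (φ T) X (S' \ T) (component X φ T) else 0 := by
      intro T hT
      rw [Finset.mem_filter, Finset.mem_ssubsets] at hT
      split_ifs with hTS'
      · rw [nablaProd_halfSpaceInverse (Finset.sdiff_subset_sdiff le_rfl hTS')
          (hφ.ne_zero_of_mem_sdiff hT.2) (isBoundedBelow_component hφ hT.2)]
        congr 1
        ext i
        have : i ∈ S' → i ∈ S := fun h => hsub.subset h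
        simp only [Finset.mem_sdiff]
        tauto
      · refine nablaProd_halfSpaceInverse_eq_zero (hφ.ne_zero_of_mem_sdiff hT.2)
          (isBoundedBelow_component hφ hT.2) ?_
        obtain ⟨i, hiT, hi⟩ := Finset.not_subset.1 hTS'
        have his : (X i : V) ∉ s := fun h => hi (Finset.mem_filter.2 ⟨hT.1.subset hiT, h⟩)
        refine nablaProd_eq_zero_of_subset X ?_ (ih T hT.1 hT.2 s ⟨i, hiT, his⟩)
        rw [← hout]
        exact Finset.filter_subset_filter _ hT.1.subset
    rw [Finset.sum_congr rfl hterm, ← Finset.sum_filter]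
    have hindex : ({T ∈ ({T ∈ S.ssubsets | IsFlat X T} : Finset (Finset ι)) | T ⊆ S'} :
        Finset (Finset ι)) = insert S' ({T ∈ S'.ssubsets | IsFlat X T} : Finset (Finset ι)) := by
      ext T
      simp only [Finset.mem_filter, Finset.mem_ssubsets, Finset.mem_insert]
      constructor
      · rintro ⟨⟨-, hT⟩, hTS'⟩
        rcases hTS'.eq_or_ssubset with h | h
        · exact Or.inl h
        · exact Or.inr ⟨h, hT⟩
      · rintro (rfl | ⟨h, hT⟩)
        · exact ⟨⟨hsub, hflat⟩, subset_rfl⟩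
        · exact ⟨⟨h.trans hsub, hT⟩, h.subset⟩
    rw [hindex, Finset.sum_insert (by simp), Finset.sdiff_self,
      halfSpaceInverse_empty (isBoundedBelow_component hφ hflat), component_eq X φ S']
    abel

/-- If the linear form of `T` is negative at `w`, then the term of `T` vanishes on `w - B(S)`: its
support is pushed up by `-φ a` for each `a` with `φ a < 0`, and subtracting elements of the
zonotope from `w` raises `φ` by no more than that. -/
theorem halfSpaceInverse_component_eq_zero (hφ : IsFlatForms X φ) {T : Finset ι} (hT : IsFlat X T)
    {S : Finset ι} (hTS : T ⊆ S) {w : V} (hw : φ T w < 0) {γ : Γ}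
    (hγ : (γ : V) ∈ subZonotope X S w) :
    halfSpaceInverse (φ T) X (S \ T) (component X φ T) γ = 0 := by
  by_contra h
  have hle := le_of_halfSpaceInverse_ne_zero (hφ.ne_zero_of_mem_sdiff hT)
    (hφ.nonneg hT (mem_spanOf_of_component_ne_zero hφ T)) h
  obtain ⟨t, ht, hγ⟩ := hγ
  rw [zero_add, hγ, map_sub, map_sum, ← Finset.sum_sdiff hTS,
    Finset.sum_eq_zero (s := T) fun i hi => by
      rw [map_smul, hφ.eq_zero T hT _ (mem_spanOf X (Finset.mem_coe.2 hi)), smul_zero],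
    add_zero] at hle
  have : -∑ i ∈ S \ T, φ T (t i • (X i : V)) ≤ ∑ i ∈ S \ T, max 0 (-φ T (X i)) := by
    rw [← Finset.sum_neg_distrib]
    refine Finset.sum_le_sum fun i hi => ?_
    obtain ⟨h0, h1⟩ := ht i (Finset.mem_sdiff.1 hi).1
    rw [map_smul, smul_eq_mul, ← mul_neg]
    exact (mul_le_mul_of_nonneg_left (le_max_right 0 _) h0).trans
      (mul_le_of_le_one_left (le_max_left _ _) h1)
  linarith

/-- The component at a flat whose span contains `v` and whose cone does not is zero: by induction
it agrees on `v - B(S)` with the partition function, which vanishes there, and Dahmen–Micchelli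
functions are determined by their values on `v - B(S)`. -/
theorem component_eq_zero (hX : ∀ i, X i ≠ 0) (hpointed : GeneratesPointedCone X)
    (hφ : IsFlatForms X φ) {v : V} (hv : ∀ T, IsFlat X T → v ∉ spanOf X T → φ T v < 0) :
    ∀ S : Finset ι, IsFlat X S → v ∈ spanOf X S → v ∉ coneOf X S → component X φ S = 0 := by
  intro S
  induction S using Finset.strongInduction with
  | H S ih =>
    intro hS hvS hvC
    have hzero : ∀ γ : Γ, (γ : V) ∈ subZonotope X S v → component X φ S γ = 0 := by
      intro γ hγ
      rw [component_eq, Pi.sub_apply, Finset.sum_apply, Finset.sum_eq_zero, sub_zero]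
      · by_contra h
        obtain ⟨t, ht, hγ⟩ := hγ
        refine hvC ?_
        rw [← sub_add_cancel v (∑ i ∈ S, t i • (X i : V)), ← hγ]
        exact Submodule.add_mem _ (mem_coneOf_of_sublistPartition_ne_zero h)
          (sum_smul_mem_coneOf X S fun i hi => (ht i hi).1)
      · intro T hT
        rw [Finset.mem_filter, Finset.mem_ssubsets] at hT
        by_cases hvT : v ∈ spanOf X T
        · rw [ih T hT.1 hT.2 hvT fun h =>
              hvC (Submodule.span_mono (Set.image_mono (Finset.coe_subset.2 hT.1.subset)) h),
            halfSpaceInverse_eq (hφ.ne_zero_of_mem_sdiff hT.2) (h := 0) ⟨0, by simp⟩ (map_zero _)]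
          rfl
        · exact halfSpaceInverse_component_eq_zero hφ hT.2 hT.1.subset (hv T hT.2 hvT) hγ
    funext γ
    by_contra h
    exact h ((isDM_component hX hpointed hφ S hS).eq_zero hvS hzero γ
      (mem_spanOf_of_component_ne_zero hφ S γ h))

end Component

/-! ### Local agreement and big cells -/

theorem exists_dual_eq_zero_forall_ne_zero [Fintype ι] (X : ι → Γ) (W : Submodule ℝ V) (v : V) :
    ∃ ψ : Module.Dual ℝ V, (∀ x ∈ W, ψ x = 0) ∧ (∀ i, (X i : V) ∉ W → ψ (X i) ≠ 0) ∧
      (v ∉ W → ψ v < 0) := by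
  let F : Option ι → V := fun o => o.elim v fun i => X i
  obtain ⟨f, hf⟩ := Module.exists_dual_forall_apply_ne_zero (K := ℝ)
    (fun o : {o : Option ι // F o ∉ W} => W.mkQ (F o)) fun o => by
      rw [Submodule.mkQ_apply, Ne, Submodule.Quotient.mk_eq_zero]
      exact o.2
  have h0 : ∀ x ∈ W, f (W.mkQ x) = 0 := fun x hx => by
    rw [Submodule.mkQ_apply, (Submodule.Quotient.mk_eq_zero W).2 hx, map_zero]
  have h1 : ∀ i, (X i : V) ∉ W → f (W.mkQ (X i)) ≠ 0 := fun i hi => hf ⟨some i, hi⟩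
  rcases le_or_gt 0 (f (W.mkQ v)) with hpos | hneg
  · refine ⟨-f ∘ₗ W.mkQ, fun x hx => ?_, fun i hi => ?_, fun hv => ?_⟩
    · simpa using h0 x hx
    · simpa using h1 i hi
    · have : 0 < f (W.mkQ v) := hpos.lt_of_ne' (hf ⟨none, hv⟩)
      simpa using this
  · exact ⟨f ∘ₗ W.mkQ, h0, h1, fun _ => hneg⟩

/-- Near a regular vector `v` the partition function agrees with a single Dahmen–Micchelli
function: with linear forms negative at `v`, every term of the decomposition but the last vanishes
on `w - B(X)` for `w` close to `v`. -/
theorem exists_isDM_eventually_eq [FiniteDimensional ℝ V] [Fintype ι] {X : ι → Γ}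
    (hX : ∀ i, X i ≠ 0) (hpointed : GeneratesPointedCone X) {v : V}
    (hv : v ∉ singularVectors X) :
    ∃ f : Γ → ℤ, IsDM X Finset.univ f ∧ ∀ᶠ w in nhds v, ∀ γ : Γ,
      (γ : V) ∈ subZonotope X Finset.univ w → partitionFunction X γ = f γ := by
  choose φ h0 h1 h2 using fun T : Finset ι => exists_dual_eq_zero_forall_ne_zero X (spanOf X T) v
  have hφ : IsFlatForms X φ :=
    ⟨fun T _ => h0 T, fun T hT i hi => h1 T i fun h => hi (hT i h)⟩
  have huniv : IsFlat X Finset.univ := fun i _ => Finset.mem_univ i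
  refine ⟨component X φ Finset.univ, isDM_component hX hpointed hφ _ huniv, ?_⟩
  have hev : ∀ᶠ w in nhds v, ∀ T : Finset ι, v ∉ spanOf X T → φ T w < 0 := by
    rw [Filter.eventually_all]
    intro T
    by_cases hvT : v ∈ spanOf X T
    · exact Filter.Eventually.of_forall fun w h => absurd hvT h
    · filter_upwards [(LinearMap.continuous_of_finiteDimensional (φ T)).continuousAt.eventually_lt
        continuousAt_const (h2 T hvT)] with w hw _ using hw
  filter_upwards [hev] with w hw γ hγ
  rw [component_eq, sublistPartition_univ, Pi.sub_apply, Finset.sum_apply, Finset.sum_eq_zero,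
    sub_zero]
  intro T hT
  rw [Finset.mem_filter, Finset.mem_ssubsets] at hT
  by_cases hvT : v ∈ spanOf X T
  · have htop : spanOf X T ≠ ⊤ := fun h =>
      hT.1.ne (Finset.eq_univ_iff_forall.2 fun i => hT.2 i (h ▸ Submodule.mem_top))
    have hcone : v ∉ coneOf X T := fun h => hv (Set.mem_iUnion₂.2 ⟨T, htop, h⟩)
    rw [component_eq_zero hX hpointed hφ (fun T _ => h2 T) T hT.2 hvT hcone,
      halfSpaceInverse_eq (hφ.ne_zero_of_mem_sdiff hT.2) (h := 0) ⟨0, by simp⟩ (map_zero _)]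
    rfl
  · exact halfSpaceInverse_component_eq_zero hφ hT.2 hT.1.subset (hw T hvT) hγ

end VectorPartition

end

theorem theorem3p13 {V : Type*} [NormedAddCommGroup V] [NormedSpace ℝ V] [FiniteDimensional ℝ V]
    (Γ : Submodule ℤ V) [DiscreteTopology Γ] [IsZLattice ℝ Γ]
    {ι : Type*} [Fintype ι] (X : ι → Γ) (hX : ∀ i, X i ≠ 0)
    (hspan : VectorPartition.spanOf X Set.univ = ⊤)
    (hpointed : VectorPartition.GeneratesPointedCone X)
    (c : Set V) (hc : VectorPartition.IsBigCell X c) :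
    ∃ f : Γ → ℤ, VectorPartition.IsQuasiPolynomial f ∧ f ∈ VectorPartition.DM X ∧
      ∀ γ : Γ, (γ : V) ∈ c - VectorPartition.zonotope X →
        VectorPartition.partitionFunction X γ = f γ := by
  open VectorPartition in
  obtain ⟨v₀, hv₀, rfl⟩ := hc
  set c := connectedComponentIn (singularVectors X)ᶜ v₀
  have hreg : ∀ v ∈ c, v ∉ singularVectors X := fun v hv => connectedComponentIn_subset _ _ hv
  have hlocal : ∀ v, ∃ f : Γ → ℤ, v ∉ singularVectors X → IsDM X Finset.univ f ∧
      ∀ᶠ w in nhds v, ∀ γ : Γ, (γ : V) ∈ subZonotope X Finset.univ w →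
        partitionFunction X γ = f γ := by
    intro v
    by_cases hv : v ∈ singularVectors X
    · exact ⟨0, fun h => absurd hv h⟩
    · obtain ⟨f, hf⟩ := exists_isDM_eventually_eq hX hpointed hv
      exact ⟨f, fun _ => hf⟩
  choose F hF using hlocal
  have htop : ∀ u : V, u ∈ spanOf X (Finset.univ : Finset ι) := fun u => by
    rw [Finset.coe_univ, hspan]
    trivial
  -- Two functions that agree with `P_X` on the same translate `y - B(X)` are equal.
  have hconst : ∀ {v w : V}, v ∈ c → w ∈ c → F v = F w := by
    intro v w hv hw
    refine isPreconnected_connectedComponentIn.induction₂ (fun v w => F v = F w) ?_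
      (fun _ _ _ _ _ _ => Eq.trans) (fun _ _ _ _ => Eq.symm) hv hw
    intro x hx
    obtain ⟨hDMx, hx'⟩ := hF x (hreg x hx)
    filter_upwards [nhdsWithin_le_nhds hx', self_mem_nhdsWithin] with y hxy hy
    obtain ⟨hDMy, hy'⟩ := hF y (hreg y hy)
    funext γ
    refine sub_eq_zero.1 ((hDMx.sub hDMy).eq_zero (htop y) (fun δ hδ => ?_) γ (htop γ))
    rw [Pi.sub_apply, ← hxy δ hδ, ← hy'.self_of_nhds δ hδ, sub_self]
  have hv₀c : v₀ ∈ c := mem_connectedComponentIn hv₀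
  have hDM := (hF v₀ hv₀).1
  refine ⟨F v₀, hDM.isQuasiPolynomial hspan, hDM.mem_DM hspan, ?_⟩
  rintro γ ⟨w, hw, b, ⟨t, ht, rfl⟩, hγ⟩
  rw [hconst hv₀c hw]
  exact (hF w (hreg w hw)).2.self_of_nhds γ ⟨t, fun i _ => ht i, hγ.symm⟩
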